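/- For a finite simple graph $G$, let $F(G)$ be the number of stable (independent) sets of $G$, including the empty set, and let the stability number of $G$ be the largest size of a stable set. For integers $1 \le \alpha \le n-1$, let $TC(n,\alpha)$ be the graph on $n$ vertices obtained from the disjoint union of $\alpha$ cliques whose orders differ by at most one by adding $\alpha-1$ edges, joining a fixed vertex of one clique of order $\lceil n/\alpha\rceil$ to one vertex of each of the other cliques (it is unique up to isomorphism). Let $G$ be a tree of order $n \ge 2$ with stability number $\alpha$. Then $\frac n2 \le \alpha \le n-1$ and $$F(G) \le 3^{\,n-\alpha-1}\, 2^{\,2\alpha-n+1} + 2^{\,n-\alpha-1},$$ with equality if and only if $G \cong TC(n,\alpha)$. Moreover, for all integers $n,\alpha$ with $\frac n2 \le \alpha \le n-1$, the graph $TC(n,\alpha)$ consists of a central vertex with $\alpha$ pendant paths attached to it, of which $n-\alpha-1$ have length $2$ and $2\alpha-n+1$ have length $1$. -/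

import Mathlib

namespace SimpleGraph

/-- The Fibonacci index of a (finite) graph: the number of its stable sets,
the empty set included. -/
noncomputable def fibonacciIndex {V : Type*} (G : SimpleGraph V) : ℕ :=
  Nat.card {s : Finset V // G.IsIndepSet (s : Set V)}

/-- The disjoint union of `α` balanced cliques on `n` vertices (`1 ≤ α ≤ n`): the cliques are the
residue classes modulo `α`. Mathlib's `turanGraph` is the complementary, complete multipartite
graph. -/
def turanCliques (n α : ℕ) : SimpleGraph (Fin n) := (turanGraph n α)ᶜ

/-- The Turán-connected graph with `n` vertices and stability number `α` (`1 ≤ α ≤ n - 1`): to the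
disjoint union of `α` balanced cliques add `α - 1` edges, which link one vertex of a clique of the
largest size (the vertex `0`, whose residue class has `⌈n / α⌉` elements) to one vertex of each of
the other cliques (the vertices `1, …, α - 1`). -/
def turanConnected (n α : ℕ) : SimpleGraph (Fin n) :=
  turanCliques n α ⊔
    SimpleGraph.fromRel (fun v w : Fin n => (v : ℕ) = 0 ∧ 1 ≤ (w : ℕ) ∧ (w : ℕ) < α)

/-- A central vertex `none` with pendant paths attached to it, one for each `i : ι`; the path `i`
has length `ℓ i`, and its vertices other than the centre are, in order from the centre,
`⟨i, 0⟩, …, ⟨i, ℓ i - 1⟩`. -/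
def pendantPaths {ι : Type*} (ℓ : ι → ℕ) : SimpleGraph (Option (Σ i, Fin (ℓ i))) :=
  SimpleGraph.fromRel fun a b =>
    match a, b with
    | none, some q => (q.2 : ℕ) = 0
    | some p, some q => p.1 = q.1 ∧ (q.2 : ℕ) = (p.2 : ℕ) + 1
    | _, none => False

end SimpleGraph

/-! Put k = n - α - 1 and m = 2α - n + 1, so that α = k + m, n = 2k + m + 1 and the bound reads 3^k
2^m + 2^k. Stable sets are counted inside vertex subsets S of one fixed graph. The distance from a
root serves as a height function: it certifies acyclicity on every subset and supplies a deepest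
vertex for strong induction on S.

Three estimates interact. A forest with 2k + m vertices and stability number k + m has at most 3^k
2^m stable sets, with equality exactly for k disjoint edges plus m isolated vertices
(`IsDepth.numStable_le`). In a forest with k = |S| - α - 1, each vertex lies in at least 2^k stable
sets (`IsDepth.two_pow_le_numStable_nonNbrs`). For a tree, take a deepest vertex v with parent w. If
another leaf hangs at w, then F(S) = F(S - v) + F(S - v - w), bounded by induction and the forest
bound. Otherwise w has a single further neighbour t, and with T = S - v - w one has F(S) = 3F(T) -
#{stable sets of T containing t}, bounded by induction and the lower estimate.

Equality is read off from the forest bound or the lower estimate, never from the induction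
hypothesis: it yields a vertex c next to a leaf whose removal leaves a matching. Such a tree is a
spider with legs of length 1 or 2, and tightness forces α legs. A spider is determined up to
isomorphism by its order and number of legs, and TC(n, α) is the spider with α legs when n ≤ 2α. -/

namespace SimpleGraph

/-! ### Counting stable sets and deletion recurrences -/

section StableSets

open scoped Classical

variable {V : Type*} (G : SimpleGraph V)

/-- The stable sets contained in `S`. -/
noncomputable def stableSets (S : Finset V) : Finset (Finset V) :=
  S.powerset.filter fun I => ∀ x ∈ I, ∀ y ∈ I, ¬ G.Adj x y

/-- The number of stable sets contained in `S`. -/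
noncomputable def numStable (S : Finset V) : ℕ := (G.stableSets S).card

/-- The largest size of a stable set contained in `S`. -/
noncomputable def maxStable (S : Finset V) : ℕ := (G.stableSets S).sup Finset.card

/-- The vertices of `S` other than `v` which are not adjacent to `v`. -/
noncomputable def nonNbrs (S : Finset V) (v : V) : Finset V :=
  S.filter fun x => x ≠ v ∧ ¬ G.Adj v x

variable {G}

lemma mem_stableSets {S I : Finset V} :
    I ∈ G.stableSets S ↔ I ⊆ S ∧ ∀ x ∈ I, ∀ y ∈ I, ¬ G.Adj x y := by
  simp [stableSets]

lemma mem_nonNbrs {S : Finset V} {v x : V} :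
    x ∈ G.nonNbrs S v ↔ x ∈ S ∧ x ≠ v ∧ ¬ G.Adj v x := by
  simp [nonNbrs]

lemma isIndepSet_coe_iff {I : Finset V} :
    G.IsIndepSet (I : Set V) ↔ ∀ x ∈ I, ∀ y ∈ I, ¬ G.Adj x y := by
  constructor
  · intro h x hx y hy hxy
    exact h hx hy hxy.ne hxy
  · intro h x hx y hy _
    exact h x hx y hy

lemma card_le_maxStable {S I : Finset V} (hS : I ⊆ S) (hI : ∀ x ∈ I, ∀ y ∈ I, ¬ G.Adj x y) :
    I.card ≤ G.maxStable S :=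
  Finset.le_sup (f := Finset.card) (mem_stableSets.2 ⟨hS, hI⟩)

lemma exists_card_eq_maxStable (G : SimpleGraph V) (S : Finset V) :
    ∃ I ⊆ S, (∀ x ∈ I, ∀ y ∈ I, ¬ G.Adj x y) ∧ I.card = G.maxStable S := by
  obtain ⟨I, hI, h⟩ := Finset.exists_mem_eq_sup (G.stableSets S)
    ⟨∅, mem_stableSets.2 (by simp)⟩ Finset.card
  obtain ⟨h1, h2⟩ := mem_stableSets.1 hI
  exact ⟨I, h1, h2, h.symm⟩

lemma maxStable_le_card (G : SimpleGraph V) (S : Finset V) : G.maxStable S ≤ S.card := by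
  obtain ⟨I, hI, -, h⟩ := exists_card_eq_maxStable G S
  exact h ▸ Finset.card_le_card hI

lemma maxStable_lt_card {S : Finset V} {x y : V} (hx : x ∈ S) (hy : y ∈ S) (h : G.Adj x y) :
    G.maxStable S < S.card := by
  obtain ⟨I, hI, hst, hc⟩ := exists_card_eq_maxStable G S
  rw [← hc]
  refine Finset.card_lt_card ⟨hI, fun hSI => ?_⟩
  exact hst x (hSI hx) y (hSI hy) h

lemma numStable_mono {S T : Finset V} (h : S ⊆ T) : G.numStable S ≤ G.numStable T := by
  refine Finset.card_le_card fun I hI => ?_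
  obtain ⟨h1, h2⟩ := mem_stableSets.1 hI
  exact mem_stableSets.2 ⟨h1.trans h, h2⟩

lemma numStable_lt {S T : Finset V} (h : S ⊂ T) : G.numStable S < G.numStable T := by
  obtain ⟨hs, x, hxT, hxS⟩ := Finset.ssubset_iff_exists_cons_subset.1 h |>.elim
    fun a ⟨ha, hh⟩ => (⟨h.1, a, hh (by simp), ha⟩ : S ⊆ T ∧ ∃ x, x ∈ T ∧ x ∉ S)
  refine Finset.card_lt_card ⟨fun I hI => ?_, fun hc => ?_⟩
  · obtain ⟨h1, h2⟩ := mem_stableSets.1 hI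
    exact mem_stableSets.2 ⟨h1.trans hs, h2⟩
  · have : {x} ∈ G.stableSets S := hc (mem_stableSets.2 ⟨by simpa using hxT, by simp⟩)
    exact hxS ((mem_stableSets.1 this).1 (by simp))

lemma numStable_eq_two_pow {S : Finset V} (h : ∀ x ∈ S, ∀ y ∈ S, ¬ G.Adj x y) :
    G.numStable S = 2 ^ S.card := by
  rw [← Finset.card_powerset]
  unfold numStable
  congr 1
  ext I
  rw [mem_stableSets, Finset.mem_powerset]
  exact ⟨fun h => h.1, fun hI => ⟨hI, fun x hx y hy => h x (hI hx) y (hI hy)⟩⟩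

/-- Split the stable sets by whether they contain v; erasing v from those that do leaves a stable
set of non-neighbours. -/
lemma numStable_eq_add {S : Finset V} {v : V} (hv : v ∈ S) :
    G.numStable S = G.numStable (S.erase v) + G.numStable (G.nonNbrs S v) := by
  have h1 : (G.stableSets S).filter (fun I => v ∉ I) = G.stableSets (S.erase v) := by
    ext I
    simp only [Finset.mem_filter, mem_stableSets, Finset.subset_erase]
    tauto
  have h2 : ((G.stableSets S).filter fun I => ¬ v ∉ I).card = G.numStable (G.nonNbrs S v) := by
    refine Finset.card_bij' (fun I _ => I.erase v) (fun I _ => insert v I) ?_ ?_ ?_ ?_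
    · intro I hI
      simp only [Finset.mem_filter, mem_stableSets, not_not] at hI
      obtain ⟨⟨hIS, hst⟩, hvI⟩ := hI
      refine mem_stableSets.2 ⟨fun x hx => ?_, fun x hx y hy => ?_⟩
      · rw [Finset.mem_erase] at hx
        exact mem_nonNbrs.2 ⟨hIS hx.2, hx.1, hst v hvI x hx.2⟩
      · exact hst x (Finset.mem_of_mem_erase hx) y (Finset.mem_of_mem_erase hy)
    · intro I hI
      obtain ⟨hIS, hst⟩ := mem_stableSets.1 hI
      simp only [Finset.mem_filter, mem_stableSets, not_not]
      refine ⟨⟨?_, ?_⟩, Finset.mem_insert_self _ _⟩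
      · intro x hx
        rcases Finset.mem_insert.1 hx with rfl | hx
        · exact hv
        · exact (mem_nonNbrs.1 (hIS hx)).1
      · intro x hx' y hy'
        obtain rfl | hx := Finset.mem_insert.1 hx' <;> obtain rfl | hy := Finset.mem_insert.1 hy'
        · simp
        · exact (mem_nonNbrs.1 (hIS hy)).2.2
        · exact fun h => (mem_nonNbrs.1 (hIS hx)).2.2 h.symm
        · exact hst x hx y hy
    · intro I hI
      simp only [Finset.mem_filter, not_not] at hI
      exact Finset.insert_erase hI.2
    · intro I hI
      refine Finset.erase_insert fun h => ?_
      exact (mem_nonNbrs.1 ((mem_stableSets.1 hI).1 h)).2.1 rfl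
  have := Finset.card_filter_add_card_filter_not (s := G.stableSets S) (fun I => v ∉ I)
  rw [h1, h2] at this
  exact this.symm

lemma nonNbrs_eq_erase {S : Finset V} {v : V} (h : ∀ x ∈ S, ¬ G.Adj v x) :
    G.nonNbrs S v = S.erase v := by
  ext x
  rw [mem_nonNbrs, Finset.mem_erase]
  exact ⟨fun hx => ⟨hx.2.1, hx.1⟩, fun hx => ⟨hx.2, hx.1, h x hx.2⟩⟩

lemma nonNbrs_eq_erase_erase {S : Finset V} {v w : V} (hvw : G.Adj v w)
    (h : ∀ x ∈ S, G.Adj v x → x = w) : G.nonNbrs S v = (S.erase v).erase w := by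
  ext x
  rw [mem_nonNbrs, Finset.mem_erase, Finset.mem_erase]
  constructor
  · rintro ⟨h1, h2, h3⟩
    exact ⟨fun h => h3 (h ▸ hvw), h2, h1⟩
  · rintro ⟨h1, h2, h3⟩
    exact ⟨h3, h2, fun hx => h1 (h x h3 hx)⟩

lemma numStable_isolated {S : Finset V} {v : V} (hv : v ∈ S) (h : ∀ x ∈ S, ¬ G.Adj v x) :
    G.numStable S = 2 * G.numStable (S.erase v) := by
  rw [numStable_eq_add hv, nonNbrs_eq_erase h, two_mul]

lemma numStable_leaf {S : Finset V} {v w : V} (hv : v ∈ S) (hvw : G.Adj v w)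
    (h : ∀ x ∈ S, G.Adj v x → x = w) :
    G.numStable S = G.numStable (S.erase v) + G.numStable ((S.erase v).erase w) := by
  rw [numStable_eq_add hv, nonNbrs_eq_erase_erase hvw h]

lemma maxStable_isolated {S : Finset V} {v : V} (hv : v ∈ S) (h : ∀ x ∈ S, ¬ G.Adj v x) :
    G.maxStable S = G.maxStable (S.erase v) + 1 := by
  apply le_antisymm
  · obtain ⟨I, hI, hst, hc⟩ := exists_card_eq_maxStable G S
    have h1 : (I.erase v).card ≤ G.maxStable (S.erase v) :=
      card_le_maxStable (Finset.erase_subset_erase _ hI) fun x hx y hy =>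
        hst x (Finset.mem_of_mem_erase hx) y (Finset.mem_of_mem_erase hy)
    have h2 := Finset.pred_card_le_card_erase (s := I) (a := v)
    omega
  · obtain ⟨I, hI, hst, hc⟩ := exists_card_eq_maxStable G (S.erase v)
    have hvI : v ∉ I := fun hx => by simpa using hI hx
    rw [← hc, ← Finset.card_insert_of_notMem hvI]
    have hIS : I ⊆ S := hI.trans (Finset.erase_subset _ _)
    refine card_le_maxStable (Finset.insert_subset hv hIS) fun x hx' y hy' => ?_
    obtain rfl | hx := Finset.mem_insert.1 hx' <;> obtain rfl | hy := Finset.mem_insert.1 hy'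
    · simp
    · exact h y (hIS hy)
    · exact fun hh => h x (hIS hx) hh.symm
    · exact hst x hx y hy

/-- A stable set contains at most one end of the edge vw, and v can be added to any stable set
avoiding w. -/
lemma maxStable_leaf {S : Finset V} {v w : V} (hv : v ∈ S) (hvw : G.Adj v w)
    (h : ∀ x ∈ S, G.Adj v x → x = w) :
    G.maxStable S = G.maxStable ((S.erase v).erase w) + 1 := by
  apply le_antisymm
  · obtain ⟨I, hI, hst, hc⟩ := exists_card_eq_maxStable G S
    have h1 : ((I.erase v).erase w).card ≤ G.maxStable ((S.erase v).erase w) :=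
      card_le_maxStable (Finset.erase_subset_erase _ (Finset.erase_subset_erase _ hI))
        fun x hx y hy => hst x (Finset.mem_of_mem_erase (Finset.mem_of_mem_erase hx)) y
          (Finset.mem_of_mem_erase (Finset.mem_of_mem_erase hy))
    have h2 := Finset.pred_card_le_card_erase (s := I) (a := v)
    by_cases hw : w ∈ I
    · have hvI : v ∉ I := fun hvI => hst v hvI w hw hvw
      rw [Finset.erase_eq_of_notMem hvI, Finset.card_erase_of_mem hw] at h1
      omega
    · rw [Finset.erase_eq_of_notMem fun hx => hw (Finset.mem_of_mem_erase hx)] at h1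
      omega
  · obtain ⟨I, hI, hst, hc⟩ := exists_card_eq_maxStable G ((S.erase v).erase w)
    have hvI : v ∉ I := fun hx => by simpa using hI hx
    have hwI : w ∉ I := fun hx => by simpa using hI hx
    rw [← hc, ← Finset.card_insert_of_notMem hvI]
    have hIS : I ⊆ S := hI.trans ((Finset.erase_subset _ _).trans (Finset.erase_subset _ _))
    refine card_le_maxStable (Finset.insert_subset hv hIS) fun x hx' y hy' => ?_
    obtain rfl | hx := Finset.mem_insert.1 hx' <;> obtain rfl | hy := Finset.mem_insert.1 hy'
    · simp
    · exact fun hh => hwI (h y (hIS hy) hh ▸ hy)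
    · exact fun hh => hwI (h x (hIS hx) hh.symm ▸ hx)
    · exact hst x hx y hy

/-- Removing the neighbour of a leaf does not change the stability number. -/
lemma maxStable_erase_support {S : Finset V} {v w : V} (hv : v ∈ S) (hvw : G.Adj v w)
    (h : ∀ x ∈ S, G.Adj v x → x = w) : G.maxStable (S.erase w) = G.maxStable S := by
  rw [maxStable_leaf hv hvw h, maxStable_isolated (S := S.erase w) (v := v), Finset.erase_right_comm]
  · exact Finset.mem_erase.2 ⟨hvw.ne, hv⟩
  · intro x hx hvx
    rw [Finset.mem_erase] at hx
    exact hx.1 (h x hx.2 hvx)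

/-- Removing one of two leaves with the same neighbour lowers the stability number by one. -/
lemma maxStable_erase_twin {S : Finset V} {u v w : V} (hu : u ∈ S) (hv : v ∈ S) (huv : u ≠ v)
    (huw : G.Adj u w) (hvw : G.Adj v w) (hu' : ∀ x ∈ S, G.Adj u x → x = w)
    (hv' : ∀ x ∈ S, G.Adj v x → x = w) : G.maxStable S = G.maxStable (S.erase v) + 1 := by
  rw [maxStable_leaf hv hvw hv', maxStable_erase_support (v := u) _ huw]
  · exact fun x hx => hu' x (Finset.mem_of_mem_erase hx)
  · exact Finset.mem_erase.2 ⟨huv, hu⟩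

end StableSets

/-! ### Extremal bounds for forests -/

section Forests

open scoped Classical

variable {V : Type*} {G : SimpleGraph V}

/-- A height function witnessing that `G` is a forest: heights of adjacent vertices differ by one,
and each vertex has at most one lower neighbour. -/
structure IsDepth (G : SimpleGraph V) (d : V → ℕ) : Prop where
  adj : ∀ {x y}, G.Adj x y → d x = d y + 1 ∨ d y = d x + 1
  unique : ∀ {x y z}, G.Adj x y → G.Adj x z → d y < d x → d z < d x → y = z

/-- Each vertex of `S` has at most one neighbour in `S`. -/
def MatchingOn (G : SimpleGraph V) (S : Finset V) : Prop :=
  ∀ v ∈ S, ∀ x ∈ S, ∀ y ∈ S, G.Adj v x → G.Adj v y → x = y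

/-- `c` is adjacent to a leaf of `G[S]`, and each vertex of `S` has at most one neighbour in `S`
other than `c`. -/
def IsCore (G : SimpleGraph V) (S : Finset V) (c : V) : Prop :=
  c ∈ S ∧ (∃ l ∈ S, G.Adj l c ∧ ∀ x ∈ S, G.Adj l x → x = c) ∧ G.MatchingOn (S.erase c)

lemma IsDepth.even_side {d : V → ℕ} (hd : G.IsDepth d) (e : ℕ) (S : Finset V) :
    ∀ x ∈ S.filter (fun x => d x % 2 = e), ∀ y ∈ S.filter (fun x => d x % 2 = e),
      ¬ G.Adj x y := by
  intro x hx y hy h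
  rw [Finset.mem_filter] at hx hy
  have := hd.adj h
  omega

/-- The parity of the height is a 2-colouring, and each colour class is stable. -/
lemma IsDepth.card_le_two_mul {d : V → ℕ} (hd : G.IsDepth d) (S : Finset V) :
    S.card ≤ 2 * G.maxStable S := by
  have h0 := card_le_maxStable (Finset.filter_subset _ _) (hd.even_side 0 S)
  have h1 := card_le_maxStable (Finset.filter_subset _ _) (hd.even_side 1 S)
  have := Finset.card_filter_add_card_filter_not (s := S) (fun x => d x % 2 = 0)
  have h2 : S.filter (fun x => ¬ d x % 2 = 0) = S.filter (fun x => d x % 2 = 1) := by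
    congr 1
    ext x
    omega
  rw [h2] at this
  omega

lemma IsDepth.unique_nbr_of_max {d : V → ℕ} (hd : G.IsDepth d) {S : Finset V} {v : V}
    (hv : ∀ x ∈ S, d x ≤ d v) {x y : V} (hx : x ∈ S) (hy : y ∈ S) (hvx : G.Adj v x)
    (hvy : G.Adj v y) : x = y := by
  refine hd.unique hvx hvy ?_ ?_
  · have := hd.adj hvx
    have := hv x hx
    omega
  · have := hd.adj hvy
    have := hv y hy
    omega

/-- Remove a deepest vertex v. If isolated, it doubles the count and lowers m. Otherwise it is a
leaf at some w, and removing both ends lowers k while multiplying the count by at most 3, exactly 3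
when vw is an isolated edge. -/
theorem IsDepth.numStable_le {d : V → ℕ} (hd : G.IsDepth d) (S : Finset V) :
    ∀ k m : ℕ, G.maxStable S = k + m → S.card = 2 * k + m →
      G.numStable S ≤ 3 ^ k * 2 ^ m ∧ (G.numStable S = 3 ^ k * 2 ^ m ↔ G.MatchingOn S) := by
  induction S using Finset.strongInduction with
  | H S ih =>
    intro k m ha hc
    rcases S.eq_empty_or_nonempty with rfl | hne
    · have hk : k = 0 := by simp at hc; omega
      have hm : m = 0 := by simp at hc; omega
      subst hk hm
      rw [numStable_eq_two_pow (by simp)]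
      simp [MatchingOn]
    obtain ⟨v, hv, hmax⟩ := Finset.exists_max_image S d hne
    by_cases hiso : ∀ x ∈ S, ¬ G.Adj v x
    · have hss := Finset.erase_ssubset hv
      have ha' := maxStable_isolated hv hiso
      have hc' := Finset.card_erase_add_one hv
      have h2 := hd.card_le_two_mul (S.erase v)
      -- If m were 0, the remaining 2k - 1 vertices would have stability number k - 1, too small for
      -- a bipartite graph.
      obtain ⟨m, rfl⟩ : ∃ m', m = m' + 1 := ⟨m - 1, by omega⟩
      obtain ⟨hle, heq⟩ := ih _ hss k m (by omega) (by omega)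
      have hM : G.MatchingOn S ↔ G.MatchingOn (S.erase v) := by
        constructor
        · exact fun h a ha x hx y hy => h a (hss.1 ha) x (hss.1 hx) y (hss.1 hy)
        · intro h a ha x hx y hy hax hay
          have hne : ∀ b ∈ S, ∀ c ∈ S, G.Adj b c → b ∈ S.erase v := by
            intro b hb c hc hbc
            refine Finset.mem_erase.2 ⟨?_, hb⟩
            rintro rfl
            exact hiso c hc hbc
          exact h a (hne a ha x hx hax) x (hne x hx a ha hax.symm) y (hne y hy a ha hay.symm) hax hay
      rw [numStable_isolated hv hiso, hM, ← heq, pow_succ]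
      constructor
      · linarith
      · constructor <;> intro <;> linarith
    · push Not at hiso
      obtain ⟨w, hw, hvw⟩ := hiso
      have hleaf : ∀ x ∈ S, G.Adj v x → x = w := fun x hx hvx =>
        hd.unique_nbr_of_max hmax hx hw hvx hvw
      have hwv : w ∈ S.erase v := Finset.mem_erase.2 ⟨hvw.ne', hw⟩
      set T := (S.erase v).erase w with hT
      have hss : T ⊂ S := (Finset.erase_ssubset hwv).trans (Finset.erase_ssubset hv)
      have ha' := maxStable_leaf hv hvw hleaf
      have hc1 := Finset.card_erase_add_one hv
      have hc2 := Finset.card_erase_add_one hwv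
      rw [← hT] at ha' hc2
      have h2 := maxStable_le_card G T
      obtain ⟨k, rfl⟩ : ∃ k', k = k' + 1 := ⟨k - 1, by omega⟩
      obtain ⟨hle, heq⟩ := ih T hss k m (by omega) (by omega)
      have hsub : G.nonNbrs (S.erase v) w ⊆ T := by
        intro x hx
        rw [mem_nonNbrs] at hx
        exact Finset.mem_erase.2 ⟨hx.2.1, hx.1⟩
      -- The stable sets containing v, those containing neither end, and those containing w give the
      -- three terms; only the last can fall short of the count on T.
      have hn : G.numStable S = 2 * G.numStable T + G.numStable (G.nonNbrs (S.erase v) w) := by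
        rw [numStable_leaf hv hvw hleaf, numStable_eq_add hwv]
        ring
      have hmono := numStable_mono (G := G) hsub
      have hmemT : ∀ x ∈ S, x ≠ v → x ≠ w → x ∈ T := fun x hx h1 h2 =>
        Finset.mem_erase.2 ⟨h2, Finset.mem_erase.2 ⟨h1, hx⟩⟩
      have hM : G.MatchingOn S ↔ G.MatchingOn T ∧ G.nonNbrs (S.erase v) w = T := by
        constructor
        · intro h
          refine ⟨fun a ha x hx y hy => h a (hss.1 ha) x (hss.1 hx) y (hss.1 hy), ?_⟩
          refine hsub.antisymm fun x hx => mem_nonNbrs.2 ?_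
          have hx1 := Finset.mem_erase.1 hx
          have hx2 := Finset.mem_erase.1 hx1.2
          exact ⟨hx1.2, hx1.1, fun hwx => hx2.1 (h w hw x hx2.2 v hv hwx hvw.symm)⟩
        · rintro ⟨h, hT'⟩ a ha x hx y hy hax hay
          have hwT : ∀ x ∈ S, G.Adj w x → x = v := by
            intro x hx hwx
            by_contra hxv
            have := hmemT x hx hxv hwx.ne'
            rw [← hT', mem_nonNbrs] at this
            exact this.2.2 hwx
          by_cases hav : a = v
          · subst hav
            rw [hleaf x hx hax, hleaf y hy hay]
          by_cases haw : a = w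
          · subst haw
            rw [hwT x hx hax, hwT y hy hay]
          have key : ∀ z ∈ S, G.Adj a z → z ∈ T := by
            intro z hz haz
            refine hmemT z hz ?_ ?_
            · rintro rfl
              exact haw (hleaf a ha haz.symm)
            · rintro rfl
              exact hav (hwT a ha haz.symm)
          exact h a (hmemT a ha hav haw) x (key x hx hax) y (key y hy hay) hax hay
      rw [hM, ← heq, hn, pow_succ]
      refine ⟨by linarith, ?_⟩
      constructor
      · intro h
        refine ⟨by linarith, ?_⟩
        by_contra hne
        have := numStable_lt (G := G) (hsub.ssubset_of_ne hne)
        linarith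
      · rintro ⟨h, h'⟩
        rw [h', h]
        ring

/-- In a forest `G[S]`, at least `2 ^ (|S| - α - 1)` stable sets contain a given vertex. -/
theorem IsDepth.two_pow_le_numStable_nonNbrs {d : V → ℕ} (hd : G.IsDepth d) {S : Finset V} {v : V}
    (hv : v ∈ S) {k : ℕ} (hk : S.card = G.maxStable S + k + 1) :
    2 ^ k ≤ G.numStable (G.nonNbrs S v) ∧
      (G.numStable (G.nonNbrs S v) = 2 ^ k → G.IsCore S v) := by
  set A := S.filter (fun x => d x % 2 = d v % 2) with hA
  set B := S.filter (fun x => ¬ d x % 2 = d v % 2) with hB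
  have hAst : ∀ x ∈ A, ∀ y ∈ A, ¬ G.Adj x y := hd.even_side _ S
  have hBst : ∀ x ∈ B, ∀ y ∈ B, ¬ G.Adj x y := by
    intro x hx y hy h
    rw [hB, Finset.mem_filter] at hx hy
    have := hd.adj h
    omega
  have hAB : A.card + B.card = S.card := Finset.card_filter_add_card_filter_not _
  have hAc : A.card ≤ G.maxStable S := card_le_maxStable (Finset.filter_subset _ _) hAst
  have hBc : B.card ≤ G.maxStable S := card_le_maxStable (Finset.filter_subset _ _) hBst
  have hvA : v ∈ A := by simp [hA, hv]
  have hA1 := Finset.card_erase_add_one hvA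
  have hsub : A.erase v ⊆ G.nonNbrs S v := by
    intro x hx
    obtain ⟨hxv, hx⟩ := Finset.mem_erase.1 hx
    exact mem_nonNbrs.2 ⟨(Finset.mem_filter.1 hx).1, hxv, hAst v hvA x hx⟩
  have hpow : G.numStable (A.erase v) = 2 ^ (A.erase v).card :=
    numStable_eq_two_pow fun x hx y hy =>
      hAst x (Finset.mem_of_mem_erase hx) y (Finset.mem_of_mem_erase hy)
  have hmono := numStable_mono (G := G) hsub
  -- The opposite side B is stable, so |A| = |S| - |B| ≥ |S| - α = k + 1.
  have hkA : k ≤ (A.erase v).card := by omega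
  have hpk : 2 ^ k ≤ 2 ^ (A.erase v).card := Nat.pow_le_pow_right (by norm_num) hkA
  refine ⟨by omega, fun heq => ?_⟩
  have hcard : (A.erase v).card = k :=
    Nat.pow_right_injective le_rfl (show 2 ^ _ = 2 ^ k by omega)
  have hnon : A.erase v = G.nonNbrs S v := by
    by_contra hne
    have := numStable_lt (G := G) (hsub.ssubset_of_ne hne)
    omega
  have hBα : B.card = G.maxStable S := by omega
  have hmemAB : ∀ x ∈ S, x ∈ A ∨ x ∈ B := by
    intro x hx
    by_cases h : d x % 2 = d v % 2
    · exact Or.inl (Finset.mem_filter.2 ⟨hx, h⟩)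
    · exact Or.inr (Finset.mem_filter.2 ⟨hx, h⟩)
  have hdisj : ∀ x ∈ A, x ∉ B := fun x hx hx' =>
    (Finset.mem_filter.1 hx').2 (Finset.mem_filter.1 hx).2
  have hvB : ∀ b ∈ B, G.Adj v b := by
    intro b hb
    by_contra hvb
    have hbv : b ≠ v := fun h => hdisj v hvA (h ▸ hb)
    have : b ∈ A.erase v := hnon ▸ mem_nonNbrs.2 ⟨(Finset.mem_filter.1 hb).1, hbv, hvb⟩
    exact hdisj b (Finset.mem_of_mem_erase this) hb
  -- there are no cycles of length four
  have hA1nbr : ∀ a ∈ A, a ≠ v → ∀ x ∈ B, ∀ y ∈ B, G.Adj a x → G.Adj a y → x = y := by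
    intro a ha hav x hx y hy hax hay
    by_contra hxy
    have e1 := hd.adj (hvB x hx)
    have e2 := hd.adj (hvB y hy)
    have e3 := hd.adj hax
    have e4 := hd.adj hay
    have u1 : ¬ (d x < d a ∧ d y < d a) := fun p => hxy (hd.unique hax hay p.1 p.2)
    have u2 : ¬ (d x < d v ∧ d y < d v) := fun p =>
      hxy (hd.unique (hvB x hx) (hvB y hy) p.1 p.2)
    have u3 : ¬ (d a < d x ∧ d v < d x) := fun p =>
      hav (hd.unique hax.symm (hvB x hx).symm p.1 p.2)
    have u4 : ¬ (d a < d y ∧ d v < d y) := fun p =>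
      hav (hd.unique hay.symm (hvB y hy).symm p.1 p.2)
    omega
  have hAS : A ⊆ S := Finset.filter_subset _ _
  have hBS : B ⊆ S := Finset.filter_subset _ _
  have hcross : ∀ a ∈ S, ∀ x ∈ S, G.Adj a x → (a ∈ A ∧ x ∈ B) ∨ (a ∈ B ∧ x ∈ A) := by
    intro a ha x hx hax
    rcases hmemAB a ha with h | h <;> rcases hmemAB x hx with h' | h'
    · exact absurd hax (hAst a h x h')
    · exact Or.inl ⟨h, h'⟩
    · exact Or.inr ⟨h, h'⟩
    · exact absurd hax (hBst a h x h')
  refine ⟨hv, ?_, ?_⟩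
  -- If no vertex of B were a leaf at v, each would have a neighbour in A other than v, distinct for
  -- distinct vertices by `hA1nbr`. Then α = |B| ≤ |A| - 1, contradicting |A| ≤ α.
  · by_contra! hno
    have hchild : ∀ b ∈ B, ∃ a ∈ A.erase v, G.Adj b a := by
      intro b hb
      obtain ⟨x, hx, hbx, hxv⟩ := hno b (hBS hb) (hvB b hb).symm
      refine ⟨x, Finset.mem_erase.2 ⟨hxv, ?_⟩, hbx⟩
      rcases hcross b (hBS hb) x hx hbx with h | h
      · exact absurd hb (hdisj b h.1)
      · exact h.2
    choose! f hf hbf using hchild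
    have hle : B.card ≤ (A.erase v).card := by
      refine Finset.card_le_card_of_injOn f hf fun x hx y hy hxy => ?_
      have hfx := Finset.mem_erase.1 (hf x hx)
      exact hA1nbr (f x) hfx.2 hfx.1 x hx y hy (hbf x hx).symm (hxy ▸ (hbf y hy).symm)
    omega
  · intro b hb x hx y hy hbx hby
    obtain ⟨hbv, hb⟩ := Finset.mem_erase.1 hb
    obtain ⟨hxv, hx⟩ := Finset.mem_erase.1 hx
    obtain ⟨hyv, hy⟩ := Finset.mem_erase.1 hy
    rcases hmemAB b hb with hbA | hbB
    · have hxB : x ∈ B := by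
        rcases hcross b hb x hx hbx with h | h
        · exact h.2
        · exact absurd h.1 (hdisj b hbA)
      have hyB : y ∈ B := by
        rcases hcross b hb y hy hby with h | h
        · exact h.2
        · exact absurd h.1 (hdisj b hbA)
      exact hA1nbr b hbA hbv x hxB y hyB hbx hby
    · have hxA : x ∈ A := by
        rcases hcross b hb x hx hbx with h | h
        · exact absurd hbB (hdisj b h.1)
        · exact h.2
      have hyA : y ∈ A := by
        rcases hcross b hb y hy hby with h | h
        · exact absurd hbB (hdisj b h.1)
        · exact h.2
      -- Replacing b in B by its two neighbours x and y would give a stable set of size α + 1, since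
      -- neither x nor y has another neighbour in B.
      by_contra hxy
      have hnb : ∀ a ∈ A, a ≠ v → G.Adj b a → ∀ z ∈ B.erase b, ¬ G.Adj a z := by
        intro a ha hav hba z hz haz
        obtain ⟨hzb, hz⟩ := Finset.mem_erase.1 hz
        exact hzb (hA1nbr a ha hav z hz b hbB haz hba.symm)
      have hyn : y ∉ B.erase b := fun h => hdisj y hyA (Finset.mem_of_mem_erase h)
      have hxn : x ∉ insert y (B.erase b) := by
        rw [Finset.mem_insert, not_or]
        exact ⟨hxy, fun h => hdisj x hxA (Finset.mem_of_mem_erase h)⟩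
      have hle := card_le_maxStable (G := G) (S := S) (I := insert x (insert y (B.erase b)))
        (Finset.insert_subset hx (Finset.insert_subset hy ((Finset.erase_subset _ _).trans hBS))) (by
          intro p hp q hq hpq
          rw [Finset.mem_insert, Finset.mem_insert] at hp hq
          have hx' := hnb x hxA hxv hbx
          have hy' := hnb y hyA hyv hby
          rcases hp with rfl | rfl | hp <;> rcases hq with rfl | rfl | hq
          · exact hpq.ne rfl
          · exact hAst _ hxA _ hyA hpq
          · exact hx' _ hq hpq
          · exact hAst _ hyA _ hxA hpq
          · exact hpq.ne rfl
          · exact hy' _ hq hpq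
          · exact hx' _ hp hpq.symm
          · exact hy' _ hp hpq.symm
          · exact hBst _ (Finset.mem_of_mem_erase hp) _ (Finset.mem_of_mem_erase hq) hpq)
      rw [Finset.card_insert_of_notMem hxn, Finset.card_insert_of_notMem hyn] at hle
      have := Finset.card_erase_add_one hbB
      omega

end Forests

/-! ### The bound for trees -/

section Trees

open scoped Classical

variable {V : Type*} {G : SimpleGraph V}

/-- Every vertex of `S` other than `r` has a lower neighbour in `S`. -/
def IsRootedAt (G : SimpleGraph V) (d : V → ℕ) (r : V) (S : Finset V) : Prop :=
  ∀ x ∈ S, x ≠ r → ∃ y ∈ S, G.Adj x y ∧ d y < d x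

/-- Being rooted stands in for connectedness; it survives deleting a vertex that is nobody's parent.
-/
lemma IsRootedAt.erase {d : V → ℕ} {r : V} {S : Finset V} (h : G.IsRootedAt d r S) {v : V}
    (hv : ∀ x ∈ S, G.Adj x v → d v < d x → False) : G.IsRootedAt d r (S.erase v) := by
  intro x hx hxr
  obtain ⟨hxv, hx⟩ := Finset.mem_erase.1 hx
  obtain ⟨y, hy, hxy, hlt⟩ := h x hx hxr
  exact ⟨y, Finset.mem_erase.2 ⟨fun hyv => hv x hx (hyv ▸ hxy) (hyv ▸ hlt), hy⟩, hxy, hlt⟩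

lemma IsRootedAt.maxStable_lt_card {d : V → ℕ} {r : V} {S : Finset V} (h : G.IsRootedAt d r S)
    (hS : 2 ≤ S.card) : G.maxStable S < S.card := by
  obtain ⟨x, hx, hxr⟩ := Finset.exists_mem_ne hS r
  obtain ⟨y, hy, hxy, -⟩ := h x hx hxr
  exact SimpleGraph.maxStable_lt_card hx hy hxy

/-- Deleting the leaf v keeps k and lowers m by one. The two terms are at most 3^k 2^(m-1) + 2^k and
3^k 2^(m-1); equality makes the forest bound tight on S - v - w, and v is isolated once w is gone,
so w is a core. -/
lemma numStable_twin_le {d : V → ℕ} (hd : G.IsDepth d) {S : Finset V} {u v w : V} {k m : ℕ}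
    (ha : G.maxStable S = k + m) (hc : S.card = 2 * k + m + 1)
    (hu : u ∈ S) (hv : v ∈ S) (hw : w ∈ S) (huv : u ≠ v)
    (huw : G.Adj u w) (hvw : G.Adj v w) (hu' : ∀ x ∈ S, G.Adj u x → x = w)
    (hv' : ∀ x ∈ S, G.Adj v x → x = w)
    (ih : ∀ m', m = m' + 1 → G.numStable (S.erase v) ≤ 3 ^ k * 2 ^ m' + 2 ^ k) :
    G.numStable S ≤ 3 ^ k * 2 ^ m + 2 ^ k ∧
      (G.numStable S = 3 ^ k * 2 ^ m + 2 ^ k → G.IsCore S w) := by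
  have h1 := maxStable_erase_twin hu hv huv huw hvw hu' hv'
  have h2 := hd.card_le_two_mul (S.erase v)
  have h3 := Finset.card_erase_add_one hv
  have hwv : w ∈ S.erase v := Finset.mem_erase.2 ⟨hvw.ne', hw⟩
  have h4 := Finset.card_erase_add_one hwv
  have h5 := maxStable_leaf hv hvw hv'
  obtain ⟨m, rfl⟩ : ∃ m', m = m' + 1 := ⟨m - 1, by omega⟩
  have h6 := ih m rfl
  obtain ⟨h7, h8⟩ := hd.numStable_le ((S.erase v).erase w) k m (by omega) (by omega)
  rw [numStable_leaf hv hvw hv', pow_succ]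
  refine ⟨by linarith, fun heq => ⟨hw, ⟨v, hv, hvw, hv'⟩, ?_⟩⟩
  have hM := h8.1 (by linarith)
  have hvx : ∀ x ∈ S.erase w, ¬ G.Adj v x := fun x hx hvx =>
    (Finset.mem_erase.1 hx).1 (hv' x (Finset.mem_erase.1 hx).2 hvx)
  intro a ha x hx y hy hax hay
  have hmem : ∀ b ∈ S.erase w, ∀ c ∈ S.erase w, G.Adj b c → b ∈ (S.erase v).erase w := by
    intro b hb c hc hbc
    rw [Finset.erase_right_comm]
    exact Finset.mem_erase.2 ⟨fun h => hvx c hc (h ▸ hbc), hb⟩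
  exact hM a (hmem a ha x hx hax) x (hmem x hx a ha hax.symm) y (hmem y hy a ha hay.symm) hax hay

/-- With T = S - u - v, splitting at u and then v gives F(S) = 2F(T) + F(T - w), and F(T - w) is
F(T) minus the number of stable sets of T containing w. -/
lemma numStable_pendantEdge {S : Finset V} {u v w : V} (hu : u ∈ S) (hv : v ∈ S) (hw : w ∈ S)
    (huw : u ≠ w) (huv : G.Adj u v) (hvw : G.Adj v w) (hu' : ∀ x ∈ S, G.Adj u x → x = v)
    (hv' : ∀ x ∈ S, G.Adj v x → x = u ∨ x = w) :
    G.numStable S + G.numStable (G.nonNbrs ((S.erase u).erase v) w) =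
      3 * G.numStable ((S.erase u).erase v) := by
  have hw' : w ∈ (S.erase u).erase v :=
    Finset.mem_erase.2 ⟨hvw.ne', Finset.mem_erase.2 ⟨huw.symm, hw⟩⟩
  have hv1 : v ∈ S.erase u := Finset.mem_erase.2 ⟨huv.ne', hv⟩
  have h1 := numStable_leaf hu huv hu'
  have h2 := numStable_eq_add (G := G) hw'
  have h3 := numStable_leaf (G := G) (S := S.erase u) hv1 hvw (by
    intro x hx hvx
    obtain ⟨hxu, hx⟩ := Finset.mem_erase.1 hx
    exact (hv' x hx hvx).resolve_left hxu)
  omega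

theorem IsDepth.numStable_le_of_isRootedAt {d : V → ℕ} (hd : G.IsDepth d) {r : V} (hr : d r = 0)
    (S : Finset V) : ∀ k m : ℕ, G.IsRootedAt d r S → 2 ≤ S.card → G.maxStable S = k + m →
      S.card = 2 * k + m + 1 →
      G.numStable S ≤ 3 ^ k * 2 ^ m + 2 ^ k ∧
        (G.numStable S = 3 ^ k * 2 ^ m + 2 ^ k → ∃ c, G.IsCore S c) := by
  induction S using Finset.strongInduction with
  | H S ih =>
    intro k m hS h2 ha hc
    obtain ⟨v, hv, hmax⟩ := Finset.exists_max_image S d (Finset.card_pos.1 (by omega))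
    have hvr : v ≠ r := by
      obtain ⟨x, hx, hxr⟩ := Finset.exists_mem_ne h2 r
      obtain ⟨y, hy, hxy, hlt⟩ := hS x hx hxr
      rintro rfl
      have := hmax x hx
      omega
    obtain ⟨w, hw, hvw, hlt⟩ := hS v hv hvr
    have hleaf : ∀ z, d z = d v → ∀ x ∈ S, ∀ y ∈ S, G.Adj z x → G.Adj z y → x = y :=
      fun z hz x hx y hy => hd.unique_nbr_of_max (fun t ht => hz ▸ hmax t ht) hx hy
    have hv' : ∀ x ∈ S, G.Adj v x → x = w := fun x hx h => hleaf v rfl x hx w hw h hvw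
    by_cases htwin : ∃ u ∈ S, u ≠ v ∧ G.Adj u w ∧ ∀ x ∈ S, G.Adj u x → x = w
    · obtain ⟨u, hu, huv, huw, hu'⟩ := htwin
      have key := numStable_twin_le hd ha hc hu hv hw huv huw hvw hu' hv' (by
        rintro m' rfl
        have h3 := Finset.card_erase_add_one hv
        have h1 := maxStable_erase_twin hu hv huv huw hvw hu' hv'
        have h4 : 2 ≤ (S.erase v).card := Finset.one_lt_card.2
          ⟨u, Finset.mem_erase.2 ⟨huv, hu⟩, w, Finset.mem_erase.2 ⟨hvw.ne', hw⟩, huw.ne⟩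
        refine (ih _ (Finset.erase_ssubset hv) k m' (hS.erase ?_) h4 (by omega) (by omega)).1
        intro x hx _ hlt
        have := hmax x hx
        omega)
      exact ⟨key.1, fun h => ⟨w, key.2 h⟩⟩
    push Not at htwin
    -- every other neighbour of `w` in `S` is lower
    have hwnb : ∀ u ∈ S, u ≠ v → G.Adj w u → d u < d w := by
      intro u hu huv hwu
      by_contra hle
      have h1 := hd.adj hwu
      have h2 := hd.adj hvw
      obtain ⟨x, hx, hux, hxw⟩ := htwin u hu huv hwu.symm
      exact hxw (hleaf u (by omega) x hx w hw hux hwu.symm)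
    have hdv := hd.adj hvw
    by_cases hwr : w = r
    · subst hwr
      -- The deepest vertex has height 1, so any further vertex would be another child of the root
      -- w, against `hwnb`.
      have hSeq : S = {v, w} := by
        ext x
        rw [Finset.mem_insert, Finset.mem_singleton]
        constructor
        · intro hx
          by_contra! hxn
          obtain ⟨y, hy, hxy, hlt⟩ := hS x hx hxn.2
          have hyw : y = w := by
            by_contra hyw
            obtain ⟨z, hz, hyz, hlt'⟩ := hS y hy hyw
            have := hmax x hx
            omega
          subst hyw
          have := hwnb x hx hxn.1 hxy.symm
          omega
        · rintro (rfl | rfl)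
          exacts [hv, hw]
      have hcard : S.card = 2 := by rw [hSeq, Finset.card_pair hvw.ne]
      have h1 := maxStable_lt_card hv hw hvw
      have h3 := hd.card_le_two_mul S
      obtain rfl : k = 0 := by omega
      obtain rfl : m = 1 := by omega
      have hE : (S.erase v).erase w = ∅ := by
        ext x
        simp [hSeq]
        tauto
      have hE' : S.erase v = {w} := by
        ext x
        simp only [hSeq, Finset.mem_erase, Finset.mem_insert, Finset.mem_singleton]
        constructor
        · tauto
        · rintro rfl
          exact ⟨hvw.ne', Or.inr rfl⟩
      have hn := numStable_leaf hv hvw hv'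
      rw [hE, hE', numStable_eq_two_pow (S := {w}) (by simp),
        numStable_eq_two_pow (S := ∅) (by simp)] at hn
      refine ⟨by simp [hn], fun _ => ⟨w, hw, ⟨v, hv, hvw, hv'⟩, ?_⟩⟩
      intro a ha x hx y hy hax _
      rw [hSeq] at ha hx
      simp only [Finset.mem_erase, Finset.mem_insert, Finset.mem_singleton] at ha hx
      have h1 := ha.2.resolve_right ha.1
      have h2 := hx.2.resolve_right hx.1
      exact absurd (h1.trans h2.symm) hax.ne
    · obtain ⟨t, ht, hwt, hltt⟩ := hS w hw hwr
      have hw' : ∀ x ∈ S, G.Adj w x → x = v ∨ x = t := by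
        intro x hx hwx
        by_cases hxv : x = v
        · exact Or.inl hxv
        · exact Or.inr (hd.unique hwx hwt (hwnb x hx hxv hwx) hltt)
      have htv : t ≠ v := by
        rintro rfl
        omega
      have hrec := numStable_pendantEdge hv hw ht htv.symm hvw hwt hv' hw'
      -- Since t is not a second leaf at w, it has a neighbour s other than w. The edge ts survives
      -- in T, so T has at least two vertices and k is positive.
      obtain ⟨s, hs, hts, hsw⟩ := htwin t ht htv hwt.symm
      have hsv : s ≠ v := by
        rintro rfl
        exact hwt.ne' (hv' t ht hts.symm)
      have hwv : w ∈ S.erase v := Finset.mem_erase.2 ⟨hvw.ne', hw⟩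
      have hT : ∀ {x}, x ∈ (S.erase v).erase w ↔ x ≠ w ∧ x ≠ v ∧ x ∈ S := by
        intro x
        rw [Finset.mem_erase, Finset.mem_erase]
      have htT := hT.2 ⟨hwt.ne', htv, ht⟩
      have hsT := hT.2 ⟨hsw, hsv, hs⟩
      have h5 := maxStable_leaf hv hvw hv'
      have h3 := Finset.card_erase_add_one hv
      have h4 := Finset.card_erase_add_one hwv
      have h6 := maxStable_lt_card htT hsT hts
      set T := (S.erase v).erase w
      obtain ⟨k, rfl⟩ : ∃ k', k = k' + 1 := ⟨k - 1, by omega⟩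
      have hTr : G.IsRootedAt d r T := by
        refine (hS.erase ?_).erase ?_
        · intro x hx _ hlt
          have := hmax x hx
          omega
        · intro x hx hxw hlt
          obtain ⟨hxv, hx⟩ := Finset.mem_erase.1 hx
          have := hwnb x hx hxv hxw.symm
          omega
      have hTS : T ⊂ S := (Finset.erase_ssubset hwv).trans (Finset.erase_ssubset hv)
      have hT1 := (ih T hTS k m hTr (Finset.one_lt_card.2 ⟨t, htT, s, hsT, hts.ne⟩)
        (by omega) (by omega)).1
      obtain ⟨hT2, hT3⟩ := hd.two_pow_le_numStable_nonNbrs (k := k) htT (by omega)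
      rw [pow_succ, pow_succ]
      -- With k now lowered by one, 3(3^k 2^m + 2^k) - 2^k = 3^(k+1) 2^m + 2^(k+1). Equality makes
      -- the lower estimate tight, so t is a core of T; adding back the edge vw, which is isolated
      -- once t is removed, keeps it a core.
      refine ⟨by linarith, fun heq => ⟨t, ht, ?_⟩⟩
      obtain ⟨-, ⟨l, hl, hlt', hl'⟩, hM⟩ := hT3 (by linarith)
      obtain ⟨hlw, hlv, hlS⟩ := hT.1 hl
      have hwx : ∀ x ∈ S, x ≠ t → G.Adj w x → x = v := fun x hx hxt h =>
        (hw' x hx h).resolve_right hxt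
      refine ⟨⟨l, hlS, hlt', fun x hx hlx => ?_⟩, ?_⟩
      · by_cases hxv : x = v
        · subst hxv
          exact absurd (hv' l hlS hlx.symm) hlw
        by_cases hxw : x = w
        · subst hxw
          exact absurd (hwx l hlS hlt'.ne hlx.symm) hlv
        exact hl' x (hT.2 ⟨hxw, hxv, hx⟩) hlx
      · intro a ha x hx y hy hax hay
        obtain ⟨hat, ha⟩ := Finset.mem_erase.1 ha
        obtain ⟨hxt, hx⟩ := Finset.mem_erase.1 hx
        obtain ⟨hyt, hy⟩ := Finset.mem_erase.1 hy
        by_cases hav : a = v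
        · subst hav
          rw [hv' x hx hax, hv' y hy hay]
        by_cases haw : a = w
        · subst haw
          rw [hwx x hx hxt hax, hwx y hy hyt hay]
        have key : ∀ z ∈ S, z ≠ t → G.Adj a z → z ∈ T.erase t := by
          intro z hz hzt haz
          refine Finset.mem_erase.2 ⟨hzt, hT.2 ⟨?_, ?_, hz⟩⟩
          · rintro rfl
            exact hav (hwx a ha hat haz.symm)
          · rintro rfl
            exact haw (hv' a ha haz.symm)
        exact hM a (Finset.mem_erase.2 ⟨hat, hT.2 ⟨haw, hav, ha⟩⟩) x (key x hx hxt hax) y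
          (key y hy hyt hay) hax hay

end Trees

/-! ### Spiders and their classification -/

section Spiders

variable {V : Type*} {G : SimpleGraph V}

/-- `G` consists of the centre `c` with pendant paths of length `1` or `2` attached to it. -/
structure IsSpider (G : SimpleGraph V) (c : V) : Prop where
  reach : ∀ v, v ≠ c → G.Adj c v ∨ ∃ u, G.Adj c u ∧ G.Adj u v
  stable : ∀ {u v}, G.Adj c u → G.Adj c v → ¬ G.Adj u v
  unique : ∀ {v x y}, v ≠ c → x ≠ c → y ≠ c → G.Adj v x → G.Adj v y → x = y

lemma IsSpider.map {W : Type*} {H : SimpleGraph W} {c : V} (h : G.IsSpider c) (e : G ≃g H) :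
    H.IsSpider (e c) := by
  have hadj : ∀ x y, H.Adj x y ↔ G.Adj (e.symm x) (e.symm y) := fun x y =>
    e.symm.map_adj_iff.symm
  have hne : ∀ x, x ≠ e c → e.symm x ≠ c := fun x hx hc => hx (by rw [← hc, e.apply_symm_apply])
  refine ⟨fun v hv => ?_, fun {u v} hu hv => ?_, fun {v x y} hv hx hy hvx hvy => ?_⟩
  · rcases h.reach _ (hne v hv) with h1 | ⟨u, h1, h2⟩
    · left
      rwa [hadj, e.symm_apply_apply]
    · refine Or.inr ⟨e u, ?_, ?_⟩
      · rwa [e.map_adj_iff]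
      · rwa [hadj, e.symm_apply_apply]
  · rw [hadj, e.symm_apply_apply] at hu hv
    rw [hadj]
    exact h.stable hu hv
  · rw [hadj] at hvx hvy
    exact e.symm.injective (h.unique (hne v hv) (hne x hx) (hne y hy) hvx hvy)

lemma pendantPaths_adj_none_some {ι : Type*} {ℓ : ι → ℕ} {q : Σ i, Fin (ℓ i)} :
    (pendantPaths ℓ).Adj none (some q) ↔ (q.2 : ℕ) = 0 := by
  simp [pendantPaths]

lemma pendantPaths_adj_some_some {ι : Type*} {ℓ : ι → ℕ} {p q : Σ i, Fin (ℓ i)} :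
    (pendantPaths ℓ).Adj (some p) (some q) ↔
      p.1 = q.1 ∧ ((q.2 : ℕ) = p.2 + 1 ∨ (p.2 : ℕ) = q.2 + 1) := by
  simp only [pendantPaths, fromRel_adj, ne_eq, Option.some.injEq]
  constructor
  · rintro ⟨-, ⟨h1, h2⟩ | ⟨h1, h2⟩⟩
    · exact ⟨h1, Or.inl h2⟩
    · exact ⟨h1.symm, Or.inr h2⟩
  · rintro ⟨h1, h2⟩
    refine ⟨?_, h2.imp (fun h => ⟨h1, h⟩) fun h => ⟨h1.symm, h⟩⟩
    rintro rfl
    omega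

/-- Relabelling the pendant paths. -/
lemma pendantPaths_congr {ι κ : Type*} (ℓ : κ → ℕ) (e : ι ≃ κ) :
    Nonempty (pendantPaths (fun i => ℓ (e i)) ≃g pendantPaths ℓ) := by
  refine ⟨⟨Equiv.optionCongr (Equiv.sigmaCongrLeft (β := fun j => Fin (ℓ j)) e), ?_⟩⟩
  rintro (_ | p) (_ | q)
  · simp
  · simp only [Equiv.optionCongr_apply, Option.map_none, Option.map_some,
      pendantPaths_adj_none_some]
    rfl
  · rw [adj_comm, adj_comm _ (some p)]
    simp only [Equiv.optionCongr_apply, Option.map_none, Option.map_some,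
      pendantPaths_adj_none_some]
    rfl
  · simp only [Equiv.optionCongr_apply, Option.map_some, pendantPaths_adj_some_some]
    exact and_congr_left' e.apply_eq_iff_eq

-- Each neighbour u of c starts a leg, of length 2 when u has a neighbour besides c and 1 otherwise.
-- `unique` makes that second vertex unique and keeps distinct legs apart; `reach` leaves no vertex
-- uncovered.
open scoped Classical in
theorem IsSpider.iso_pendantPaths {c : V} (h : G.IsSpider c) :
    ∃ ℓ : G.neighborSet c → ℕ, (∀ i, ℓ i = 1 ∨ ℓ i = 2) ∧ Nonempty (pendantPaths ℓ ≃g G) := by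
  have hex : ∀ u, ∃ w, (∃ x, x ≠ c ∧ G.Adj u x) → w ≠ c ∧ G.Adj u w := by
    intro u
    by_cases hu : ∃ x, x ≠ c ∧ G.Adj u x
    · obtain ⟨x, hx⟩ := hu
      exact ⟨x, fun _ => hx⟩
    · exact ⟨c, fun h => absurd h hu⟩
  choose g hg using hex
  let ℓ : G.neighborSet c → ℕ := fun u => if ∃ x, x ≠ c ∧ G.Adj (u : V) x then 2 else 1
  have hℓ : ∀ u, ℓ u = 1 ∨ ℓ u = 2 := by
    intro u
    by_cases hu : ∃ x, x ≠ c ∧ G.Adj (u : V) x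
    · exact Or.inr (if_pos hu)
    · exact Or.inl (if_neg hu)
  have hfar : ∀ p : Σ i, Fin (ℓ i), (p.2 : ℕ) ≠ 0 →
      (p.2 : ℕ) = 1 ∧ g p.1 ≠ c ∧ G.Adj (p.1 : V) (g p.1) := by
    rintro ⟨u, j⟩ hj
    by_cases hu : ∃ x, x ≠ c ∧ G.Adj (u : V) x
    · have : ℓ u = 2 := if_pos hu
      have := j.2
      exact ⟨by simp only at hj ⊢; omega, hg u hu⟩
    · have : ℓ u = 1 := if_neg hu
      have := j.2
      simp only at hj
      omega
  have hnadj : ∀ p : Σ i, Fin (ℓ i), (p.2 : ℕ) ≠ 0 → ¬ G.Adj c (g p.1) := fun p hp hc =>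
    h.stable p.1.2 hc (hfar p hp).2.2
  have hnc : ∀ u : G.neighborSet c, (u : V) ≠ c := fun u => G.ne_of_adj u.2 |>.symm
  have hback : ∀ p q : Σ i, Fin (ℓ i), (q.2 : ℕ) ≠ 0 → G.Adj (p.1 : V) (g q.1) → p.1 = q.1 := by
    intro p q hq hpq
    obtain ⟨-, h1, h2⟩ := hfar q hq
    exact Subtype.ext (h.unique h1 (hnc _) (hnc _) hpq.symm h2.symm)
  let f : Option (Σ i, Fin (ℓ i)) → V := fun a =>
    a.elim c fun p => if (p.2 : ℕ) = 0 then p.1 else g p.1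
  have f0 : ∀ p : Σ i, Fin (ℓ i), (p.2 : ℕ) = 0 → f (some p) = p.1 := fun p hp => if_pos hp
  have f1 : ∀ p : Σ i, Fin (ℓ i), (p.2 : ℕ) ≠ 0 → f (some p) = g p.1 := fun p hp => if_neg hp
  have fn : f none = c := rfl
  have hext : ∀ p q : Σ i, Fin (ℓ i), p.1 = q.1 → (p.2 : ℕ) = q.2 → p = q := by
    rintro ⟨u, i⟩ ⟨w, j⟩ h1 h2
    simp only at h1
    subst h1
    congr 1
    exact Fin.ext h2
  have hsome : ∀ p, f (some p) ≠ c := by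
    intro p
    by_cases hp : (p.2 : ℕ) = 0
    · rw [f0 p hp]
      exact hnc _
    · rw [f1 p hp]
      exact (hfar p hp).2.1
  have hns : ∀ p, G.Adj c (f (some p)) ↔ (p.2 : ℕ) = 0 := by
    intro p
    by_cases hp : (p.2 : ℕ) = 0
    · rw [f0 p hp]
      exact iff_of_true p.1.2 hp
    · rw [f1 p hp]
      exact iff_of_false (hnadj p hp) hp
  have hinj : Function.Injective f := by
    rintro (_ | p) (_ | q) hpq
    · rfl
    · exact absurd hpq.symm (hsome q)
    · exact absurd hpq (hsome p)
    · have hz : (p.2 : ℕ) = 0 ↔ (q.2 : ℕ) = 0 := by rw [← hns, ← hns, hpq]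
      by_cases hp : (p.2 : ℕ) = 0
      · have hq := hz.1 hp
        rw [f0 p hp, f0 q hq] at hpq
        rw [hext p q (Subtype.ext hpq) (hp.trans hq.symm)]
      · have hq : (q.2 : ℕ) ≠ 0 := fun hq => hp (hz.2 hq)
        rw [f1 p hp, f1 q hq] at hpq
        obtain ⟨hp1, -, hp2⟩ := hfar p hp
        rw [hext p q (hback p q hq (hpq ▸ hp2)) (hp1.trans (hfar q hq).1.symm)]
  have hsurj : Function.Surjective f := by
    intro v
    by_cases hv : v = c
    · exact ⟨none, hv.symm⟩
    rcases h.reach v hv with hcv | ⟨u, hcu, huv⟩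
    · exact ⟨some ⟨⟨v, hcv⟩, ⟨0, by have := hℓ ⟨v, hcv⟩; omega⟩⟩, f0 _ rfl⟩
    · have hu : ∃ x, x ≠ c ∧ G.Adj u x := ⟨v, hv, huv⟩
      have hu2 : ℓ ⟨u, hcu⟩ = 2 := if_pos hu
      refine ⟨some ⟨⟨u, hcu⟩, ⟨1, by omega⟩⟩, (f1 _ one_ne_zero).trans ?_⟩
      obtain ⟨h1, h2⟩ := hg u hu
      exact h.unique hcu.ne' h1 hv h2 huv
  have hbij : Function.Bijective f := ⟨hinj, hsurj⟩
  refine ⟨ℓ, hℓ, ⟨⟨Equiv.ofBijective f hbij, ?_⟩⟩⟩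
  rintro (_ | p) (_ | q)
  · simp
  · rw [Equiv.ofBijective_apply, Equiv.ofBijective_apply, fn, hns, pendantPaths_adj_none_some]
  · rw [Equiv.ofBijective_apply, Equiv.ofBijective_apply, fn, adj_comm, hns, adj_comm,
      pendantPaths_adj_none_some]
  · rw [Equiv.ofBijective_apply, Equiv.ofBijective_apply, pendantPaths_adj_some_some]
    by_cases hp : (p.2 : ℕ) = 0 <;> by_cases hq : (q.2 : ℕ) = 0
    · rw [f0 p hp, f0 q hq]
      exact iff_of_false (h.stable p.1.2 q.1.2) (by omega)
    · have hq1 := (hfar q hq).1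
      rw [f0 p hp, f1 q hq]
      refine ⟨fun hpq => ⟨hback p q hq hpq, by omega⟩, fun hpq => ?_⟩
      rw [hpq.1]
      exact (hfar q hq).2.2
    · have hp1 := (hfar p hp).1
      rw [f1 p hp, f0 q hq]
      refine ⟨fun hpq => ⟨(hback q p hp hpq.symm).symm, by omega⟩, fun hpq => ?_⟩
      rw [hpq.1]
      exact hpq.1 ▸ (hfar p hp).2.2.symm
    · obtain ⟨hp1, hp2, hp3⟩ := hfar p hp
      obtain ⟨hq1, hq2, hq3⟩ := hfar q hq
      rw [f1 p hp, f1 q hq]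
      refine iff_of_false (fun hpq => hnadj q hq ?_) (by omega)
      rw [h.unique hp2 hq2 (hnc p.1) hpq hp3.symm]
      exact p.1.2

lemma card_fibers_one_two {ι : Type*} [Fintype ι] {ℓ : ι → ℕ} (h : ∀ i, ℓ i = 1 ∨ ℓ i = 2) :
    Nat.card {i // ℓ i = 1} + Nat.card {i // ℓ i = 2} = Nat.card ι ∧
      Nat.card {i // ℓ i = 1} + 2 * Nat.card {i // ℓ i = 2} = ∑ i, ℓ i := by
  simp only [Nat.card_eq_fintype_card, Fintype.card_subtype, Finset.card_filter]
  rw [← Finset.card_univ, Finset.card_eq_sum_ones, Finset.mul_sum, ← Finset.sum_add_distrib,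
    ← Finset.sum_add_distrib]
  constructor <;> refine Finset.sum_congr rfl fun i _ => ?_ <;> rcases h i with h | h <;> simp [h]

/-- A spider with `α` legs is a centre with pendant paths whose numbers are determined. -/
theorem IsSpider.exists_iso [Fintype V] {c : V} (h : G.IsSpider c) {α : ℕ}
    (hα : Nat.card (G.neighborSet c) = α) :
    ∃ ℓ : Fin α → ℕ, (∀ i, ℓ i = 1 ∨ ℓ i = 2) ∧
      Nat.card {i // ℓ i = 1} + Nat.card {i // ℓ i = 2} = α ∧
      Nat.card {i // ℓ i = 1} + 2 * Nat.card {i // ℓ i = 2} + 1 = Fintype.card V ∧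
      Nonempty (G ≃g pendantPaths ℓ) := by
  obtain ⟨ℓ, hℓ, ⟨φ⟩⟩ := h.iso_pendantPaths
  have e : Fin α ≃ G.neighborSet c := (Finite.equivFinOfCardEq hα).symm
  obtain ⟨ψ⟩ := pendantPaths_congr ℓ e
  have hℓ' : ∀ i, ℓ (e i) = 1 ∨ ℓ (e i) = 2 := fun i => hℓ (e i)
  obtain ⟨h1, h2⟩ := card_fibers_one_two hℓ'
  refine ⟨fun i => ℓ (e i), hℓ', by simpa using h1, ?_, ⟨(ψ.trans φ).symm⟩⟩
  rw [h2, Fintype.card_congr (ψ.trans φ).symm.toEquiv, Fintype.card_option, Fintype.card_sigma]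
  simp

/-- The number of legs and the order form a linear system that fixes the numbers of legs of each
length, so the legs can be matched by length. -/
theorem IsSpider.iso {W : Type*} {H : SimpleGraph W} [Fintype V] [Fintype W] {c : V} {c' : W}
    (h : G.IsSpider c) (h' : H.IsSpider c') (hcard : Fintype.card V = Fintype.card W)
    (hdeg : Nat.card (G.neighborSet c) = Nat.card (H.neighborSet c')) : Nonempty (G ≃g H) := by
  obtain ⟨ℓ, hℓ, h1, h2, ⟨φ⟩⟩ := h.exists_iso hdeg
  obtain ⟨ℓ', hℓ', h1', h2', ⟨φ'⟩⟩ := h'.exists_iso rfl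
  have hfib : ∀ j, Nonempty ({i // ℓ i = j} ≃ {i // ℓ' i = j}) := by
    intro j
    refine Finite.card_eq.1 ?_
    by_cases hj1 : j = 1
    · subst hj1
      omega
    by_cases hj2 : j = 2
    · subst hj2
      omega
    have : IsEmpty {i // ℓ i = j} := ⟨fun i => by have := hℓ i; have := i.2; omega⟩
    have : IsEmpty {i // ℓ' i = j} := ⟨fun i => by have := hℓ' i; have := i.2; omega⟩
    rw [Nat.card_of_isEmpty, Nat.card_of_isEmpty]
  have he : ∃ e : Fin _ ≃ Fin _, ∀ i, ℓ' (e i) = ℓ i :=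
    ⟨Equiv.ofFiberEquiv (fun j => (hfib j).some), Equiv.ofFiberEquiv_map _⟩
  obtain ⟨e, he⟩ := he
  obtain ⟨ψ⟩ := pendantPaths_congr ℓ' e
  obtain rfl : (fun i => ℓ' (e i)) = ℓ := funext he
  exact ⟨(φ.trans ψ).trans φ'.symm⟩

/-! ### Turán-connected graphs as spiders -/

/-- For n ≤ 2α each residue class has at most two elements, so every clique edge joins some x to x +
α. -/
lemma turanConnected_adj {n α : ℕ} (hn : n ≤ 2 * α) {v w : Fin n} :
    (turanConnected n α).Adj v w ↔ (v : ℕ) + α = w ∨ (w : ℕ) + α = v ∨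
      ((v : ℕ) = 0 ∧ 1 ≤ (w : ℕ) ∧ (w : ℕ) < α) ∨ ((w : ℕ) = 0 ∧ 1 ≤ (v : ℕ) ∧ (v : ℕ) < α) := by
  have hmod : ∀ x : Fin n, ((x : ℕ) < α ∧ (x : ℕ) % α = x) ∨
      (α ≤ (x : ℕ) ∧ (x : ℕ) % α = x - α) := by
    intro x
    rcases lt_or_ge (x : ℕ) α with hx | hx
    · exact Or.inl ⟨hx, Nat.mod_eq_of_lt hx⟩
    · refine Or.inr ⟨hx, ?_⟩
      rw [Nat.mod_eq_sub_mod hx, Nat.mod_eq_of_lt (by omega)]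
  have h1 := hmod v
  have h2 := hmod w
  simp only [turanConnected, turanCliques, sup_adj, compl_adj, turanGraph, fromRel_adj, ne_eq,
    Fin.ext_iff, not_not]
  omega

lemma turanConnected_isSpider {n α : ℕ} (hn : n ≤ 2 * α) (hα : α + 1 ≤ n) {c : Fin n}
    (hc : (c : ℕ) = 0) : (turanConnected n α).IsSpider c := by
  refine ⟨fun v hv => ?_, fun {u v} hu hv => ?_, fun {v x y} hv hx hy hvx hvy => ?_⟩
  · have hv0 : (v : ℕ) ≠ 0 := fun h => hv (Fin.ext (h.trans hc.symm))
    by_cases hvα : (v : ℕ) ≤ α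
    · left
      rw [turanConnected_adj hn]
      omega
    -- A vertex beyond α is the far end of a leg, and its clique mate v - α is joined to 0.
    · refine Or.inr ⟨⟨v - α, by omega⟩, ?_, ?_⟩ <;> rw [turanConnected_adj hn] <;> simp only <;>
        omega
  · rw [turanConnected_adj hn] at *
    omega
  · rw [turanConnected_adj hn] at hvx hvy
    simp only [ne_eq, Fin.ext_iff] at hv hx hy ⊢
    omega

lemma card_neighborSet_turanConnected {n α : ℕ} (hn : n ≤ 2 * α) (hα : α + 1 ≤ n) {c : Fin n}
    (hc : (c : ℕ) = 0) : Nat.card ((turanConnected n α).neighborSet c) = α := by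
  -- The neighbours of 0 are 1, …, α - 1 by the added edges, and α as its clique mate.
  let f : Fin α → (turanConnected n α).neighborSet c := fun i =>
    ⟨⟨i + 1, by omega⟩, by
      rw [mem_neighborSet, turanConnected_adj hn]
      simp only
      omega⟩
  have hf : Function.Bijective f := by
    constructor
    · intro i j hij
      have := congrArg Fin.val (congrArg Subtype.val hij)
      simp only [f] at this
      exact Fin.ext (by omega)
    · rintro ⟨x, hx⟩
      rw [mem_neighborSet, turanConnected_adj hn] at hx
      refine ⟨⟨x - 1, by omega⟩, Subtype.ext (Fin.ext ?_)⟩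
      simp only [f]
      omega
  rw [← Nat.card_eq_of_bijective f hf, Nat.card_eq_fintype_card, Fintype.card_fin]

end Spiders

/-! ### From trees to the extremal spiders -/

section TreeIndex

open scoped Classical

variable {V : Type*} {G : SimpleGraph V}

/-- A shortest path from r to a lower neighbour y of x cannot pass through x, so y must be the
penultimate vertex of the unique path from r to x. -/
lemma IsTree.isDepth (hG : G.IsTree) (r : V) : G.IsDepth (G.dist r) := by
  refine ⟨fun h => hG.dist_eq_dist_add_one_of_adj r h, fun {x y z} hxy hxz hy hz => ?_⟩
  obtain ⟨p, hp, -⟩ := hG.connected.exists_path_of_dist r x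
  have aux : ∀ y, G.Adj x y → G.dist r y < G.dist r x → y = p.penultimate := by
    intro y hxy hlt
    obtain ⟨q, hq, hql⟩ := hG.connected.exists_path_of_dist r y
    refine hG.isAcyclic.eq_penultimate_of_adj_end hp hxy ?_
    refine hG.isAcyclic.mem_support_of_ne_mem_support_of_adj_of_isPath hp hq hxy fun hx => ?_
    have h1 := G.dist_le (q.takeUntil x hx)
    have h2 := q.length_takeUntil_le_length hx
    omega
  rw [aux y hxy hy, aux z hxz hz]

lemma IsTree.isRootedAt_univ [Fintype V] (hG : G.IsTree) (r : V) :
    G.IsRootedAt (G.dist r) r Finset.univ := by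
  intro x _ hxr
  obtain ⟨p, hp⟩ := hG.connected.exists_walk_length_eq_dist x r
  cases p with
  | nil => exact absurd rfl hxr
  | cons h q =>
    refine ⟨_, Finset.mem_univ _, h, ?_⟩
    have := G.dist_le q
    rw [Walk.length_cons] at hp
    rw [dist_comm, G.dist_comm (u := r)]
    omega

lemma maxStable_univ [Fintype V] : G.maxStable Finset.univ = G.indepNum := by
  apply le_antisymm
  · obtain ⟨I, -, hI, hc⟩ := exists_card_eq_maxStable G Finset.univ
    exact hc ▸ (isIndepSet_coe_iff.2 hI).card_le_indepNum
  · obtain ⟨I, hI⟩ := G.exists_isNIndepSet_indepNum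
    exact hI.card_eq ▸ card_le_maxStable (Finset.subset_univ _) (isIndepSet_coe_iff.1 hI.isIndepSet)

lemma fibonacciIndex_eq_numStable [Fintype V] : G.fibonacciIndex = G.numStable Finset.univ := by
  rw [fibonacciIndex, Nat.card_eq_fintype_card, Fintype.card_subtype, numStable]
  congr 1
  ext I
  rw [Finset.mem_filter, mem_stableSets, isIndepSet_coe_iff]
  simp

/-- Root the tree at c: a vertex at distance 3 or more would have a parent with two neighbours other
than c, and two neighbours of c have equal height, so they are not adjacent. -/
lemma IsTree.isSpider_of_isCore [Fintype V] (hG : G.IsTree) {c : V}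
    (hc : G.IsCore Finset.univ c) : G.IsSpider c := by
  have hM : ∀ {v x y}, v ≠ c → x ≠ c → y ≠ c → G.Adj v x → G.Adj v y → x = y := by
    intro v x y hv hx hy
    exact hc.2.2 v (Finset.mem_erase.2 ⟨hv, Finset.mem_univ _⟩) x
      (Finset.mem_erase.2 ⟨hx, Finset.mem_univ _⟩) y (Finset.mem_erase.2 ⟨hy, Finset.mem_univ _⟩)
  refine ⟨fun v hv => ?_, fun {u v} hu hv huv => ?_, hM⟩
  · obtain ⟨p, -, hvp, hlt⟩ := hG.isRootedAt_univ c v (Finset.mem_univ _) hv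
    by_cases hpc : p = c
    · exact Or.inl (hpc ▸ hvp.symm)
    obtain ⟨q, -, hpq, hlt'⟩ := hG.isRootedAt_univ c p (Finset.mem_univ _) hpc
    by_cases hqc : q = c
    · exact Or.inr ⟨p, hqc ▸ hpq.symm, hvp.symm⟩
    · have := hM hpc hv hqc hvp.symm hpq
      subst this
      omega
  · have h1 := (hG.isDepth c).adj hu
    have h2 := (hG.isDepth c).adj hv
    have h3 := (hG.isDepth c).adj huv
    omega

/-- The far ends of the legs form a stable set: the only neighbour of each, other than c, is a
neighbour of c. -/
lemma IsSpider.numStable_univ [Fintype V] {c : V} (h : G.IsSpider c) :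
    G.numStable Finset.univ =
      G.numStable (Finset.univ.erase c) + 2 ^ (G.nonNbrs Finset.univ c).card := by
  rw [numStable_eq_add (Finset.mem_univ c), numStable_eq_two_pow (S := G.nonNbrs Finset.univ c)]
  intro x hx y hy hxy
  obtain ⟨-, hxc, hcx⟩ := mem_nonNbrs.1 hx
  obtain ⟨-, hyc, hcy⟩ := mem_nonNbrs.1 hy
  obtain ⟨u, hcu, hux⟩ := (h.reach x hxc).resolve_left hcx
  exact hcy (h.unique hxc hyc hcu.ne' hxy hux.symm ▸ hcu)

lemma card_nonNbrs_univ [Fintype V] (c : V) :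
    (G.nonNbrs Finset.univ c).card + Nat.card (G.neighborSet c) + 1 = Fintype.card V := by
  have h1 := Finset.card_filter_add_card_filter_not (s := Finset.univ.erase c) (fun x => G.Adj c x)
  have h2 : (Finset.univ.erase c).filter (fun x => ¬ G.Adj c x) = G.nonNbrs Finset.univ c := by
    ext x
    simp [mem_nonNbrs]
  have h3 : Nat.card (G.neighborSet c) = ((Finset.univ.erase c).filter fun x => G.Adj c x).card := by
    have : ∀ x, x ∈ (Finset.univ.erase c).filter (fun x => G.Adj c x) ↔ x ∈ G.neighborSet c := by
      intro x
      simp only [Finset.mem_filter, Finset.mem_erase, Finset.mem_univ, and_true, mem_neighborSet]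
      exact ⟨fun h => h.2, fun h => ⟨h.ne', h⟩⟩
    rw [Nat.card_congr (Equiv.subtypeEquivRight this).symm, Nat.card_eq_fintype_card,
      Fintype.card_coe]
  have h4 := Finset.card_erase_add_one (Finset.mem_univ c)
  rw [h2] at h1
  rw [Finset.card_univ] at h4
  omega

lemma IsSpider.matchingOn [Fintype V] {c : V} (h : G.IsSpider c) :
    G.MatchingOn (Finset.univ.erase c) := fun _ hv _ hx _ hy =>
  h.unique (Finset.ne_of_mem_erase hv) (Finset.ne_of_mem_erase hx) (Finset.ne_of_mem_erase hy)

/-- A tree attains the bound if and only if it is a spider with as many legs as its stability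
number. -/
theorem IsTree.numStable_eq_iff [Fintype V] (hG : G.IsTree) {k m : ℕ}
    (hα : G.indepNum = k + m) (hn : Fintype.card V = 2 * k + m + 1) (h2 : 2 ≤ Fintype.card V) :
    G.numStable Finset.univ ≤ 3 ^ k * 2 ^ m + 2 ^ k ∧
      (G.numStable Finset.univ = 3 ^ k * 2 ^ m + 2 ^ k ↔
        ∃ c, G.IsSpider c ∧ Nat.card (G.neighborSet c) = k + m) := by
  obtain ⟨r⟩ := hG.connected.nonempty
  have hd := hG.isDepth r
  rw [← maxStable_univ] at hα
  rw [← Finset.card_univ] at hn h2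
  obtain ⟨hle, heq⟩ := hd.numStable_le_of_isRootedAt (dist_self) Finset.univ k m
    (hG.isRootedAt_univ r) h2 hα hn
  refine ⟨hle, fun h => ?_, ?_⟩
  · obtain ⟨c, hc⟩ := heq h
    have hs := hG.isSpider_of_isCore hc
    refine ⟨c, hs, ?_⟩
    obtain ⟨l, hl, hlc, hl'⟩ := hc.2.1
    have h4 := Finset.card_erase_add_one (Finset.mem_univ c)
    -- The leaf at c keeps the stability number at k + m after c is deleted, so the matching left
    -- has exactly 3^k 2^m stable sets. The remaining term 2^k then counts k far ends, hence k + m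
    -- legs.
    have h5 := maxStable_erase_support hl hlc hl'
    have h6 := (hd.numStable_le (Finset.univ.erase c) k m (by omega) (by omega)).2.2 hs.matchingOn
    rw [hs.numStable_univ, h6] at h
    have h7 := Nat.pow_right_injective le_rfl (Nat.add_left_cancel h)
    have h8 := card_nonNbrs_univ (G := G) c
    rw [← Finset.card_univ] at h8
    omega
  · rintro ⟨c, hs, hdeg⟩
    have h4 := Finset.card_erase_add_one (Finset.mem_univ c)
    have h8 := card_nonNbrs_univ (G := G) c
    rw [← Finset.card_univ] at h8
    -- The α neighbours of c form a maximum stable set avoiding c. The leg count matters: a spider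
    -- whose legs all have length 2 has stability number one more than its number of legs.
    have h9 : (G.neighborSet c).toFinset.card ≤ G.maxStable (Finset.univ.erase c) := by
      refine card_le_maxStable (fun x hx => ?_) fun x hx y hy => ?_
      · rw [Set.mem_toFinset, mem_neighborSet] at hx
        exact Finset.mem_erase.2 ⟨hx.ne', Finset.mem_univ _⟩
      · rw [Set.mem_toFinset, mem_neighborSet] at hx hy
        exact hs.stable hx hy
    rw [Set.toFinset_card, ← Nat.card_eq_fintype_card] at h9
    have h10 : G.maxStable (Finset.univ.erase c) ≤ G.maxStable Finset.univ := by
      obtain ⟨I, -, hI, hc⟩ := exists_card_eq_maxStable G (Finset.univ.erase c)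
      exact hc ▸ card_le_maxStable (Finset.subset_univ _) hI
    have h6 := (hd.numStable_le (Finset.univ.erase c) k m (by omega) (by omega)).2.2 hs.matchingOn
    rw [hs.numStable_univ, h6, show (G.nonNbrs Finset.univ c).card = k by omega]

end TreeIndex

end SimpleGraph

theorem corollary4p4 :
    (∀ (V : Type*) [Fintype V] (G : SimpleGraph V) (n α : ℕ),
      G.IsTree → Fintype.card V = n → G.indepNum = α → 2 ≤ n →
        (n ≤ 2 * α ∧ α + 1 ≤ n) ∧
        (G.fibonacciIndex : ℚ) ≤
          3 ^ ((n : ℤ) - α - 1) * 2 ^ (2 * (α : ℤ) - n + 1) + 2 ^ ((n : ℤ) - α - 1) ∧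
        ((G.fibonacciIndex : ℚ) =
            3 ^ ((n : ℤ) - α - 1) * 2 ^ (2 * (α : ℤ) - n + 1) + 2 ^ ((n : ℤ) - α - 1) ↔
          Nonempty (G ≃g SimpleGraph.turanConnected n α))) ∧
    (∀ n α : ℕ, n ≤ 2 * α → α + 1 ≤ n →
      ∃ ℓ : Fin α → ℕ,
        (∀ i, ℓ i = 1 ∨ ℓ i = 2) ∧
        (Nat.card {i // ℓ i = 2} : ℤ) = (n : ℤ) - α - 1 ∧
        (Nat.card {i // ℓ i = 1} : ℤ) = 2 * (α : ℤ) - n + 1 ∧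
        Nonempty (SimpleGraph.turanConnected n α ≃g SimpleGraph.pendantPaths ℓ)) := by
  open SimpleGraph in
  constructor
  · intro V _ G n α hG hn hα h2
    obtain ⟨r⟩ := hG.connected.nonempty
    have h1 := (hG.isDepth r).card_le_two_mul Finset.univ
    have h3 := (hG.isRootedAt_univ r).maxStable_lt_card (by rwa [Finset.card_univ, hn])
    rw [maxStable_univ, Finset.card_univ, hα, hn] at h1 h3
    -- The inequalities n/2 ≤ α ≤ n - 1 make both integer exponents natural numbers k and m.
    obtain ⟨k, hk⟩ : ∃ k, n = α + k + 1 := ⟨n - α - 1, by omega⟩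
    obtain ⟨m, hm⟩ : ∃ m, α = k + m := ⟨α - k, by omega⟩
    obtain ⟨hle, heq⟩ := hG.numStable_eq_iff (hα.trans hm) (by omega) (by omega)
    have e1 : (n : ℤ) - α - 1 = (k : ℕ) := by omega
    have e2 : 2 * (α : ℤ) - n + 1 = (m : ℕ) := by omega
    rw [e1, e2, fibonacciIndex_eq_numStable]
    simp only [zpow_natCast]
    refine ⟨⟨h1, h3⟩, by exact_mod_cast hle, ?_⟩
    have hcast : (G.numStable Finset.univ : ℚ) = 3 ^ k * 2 ^ m + 2 ^ k ↔
        G.numStable Finset.univ = 3 ^ k * 2 ^ m + 2 ^ k := by norm_cast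
    rw [hcast, heq]
    have hs := turanConnected_isSpider h1 h3 (c := ⟨0, by omega⟩) rfl
    have hdeg := card_neighborSet_turanConnected h1 h3 (c := ⟨0, by omega⟩) rfl
    constructor
    · rintro ⟨c, hc, hcd⟩
      exact hc.iso hs (by rw [hn, Fintype.card_fin]) (by rw [hcd, hdeg, hm])
    · rintro ⟨φ⟩
      exact ⟨_, hs.map φ.symm,
        (Nat.card_congr (φ.symm.mapNeighborSet _)).symm.trans (hdeg.trans hm)⟩
  · intro n α hn hα
    have hs := turanConnected_isSpider hn hα (c := ⟨0, by omega⟩) rfl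
    obtain ⟨ℓ, hℓ, h1, h2, hφ⟩ := hs.exists_iso (card_neighborSet_turanConnected hn hα rfl)
    rw [Fintype.card_fin] at h2
    exact ⟨ℓ, hℓ, by omega, by omega, hφ⟩
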